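/- **Theorem.** Let $T$ be a complete first-order theory in a (one-sorted) language $L$ with NIP, i.e. for every $L$-formula $\varphi(x,y)$ ($x,y$ finite tuples of variables) there is $k\in\mathbb N$ such that no model of $T$ contains tuples $(a_i)_{i<k}$, $(b_S)_{S\subseteq\{0,\dots,k-1\}}$ with $\varphi(a_i,b_S)\iff i\in S$. Let $M\models T$, let $n\in\mathbb N$, and let $S_n(M)$ be the (Stone) space of complete types over $M$ in the $n$-tuple of variables $x$. Suppose that every $p\in S_n(M)$ is definable, i.e. for every $L$-formula $\varphi(x,y)$ the set $\{b\in M^{|y|}:\varphi(x,b)\in p\}$ is definable in $M$ with parameters from $M$. (This holds for all $n$ if all types over $M$ are definable.) Then: 1. Every Borel probability measure $\mu$ on $S_n(M)$ is definable: for every $L$-formula $\varphi(x,y)$ and all disjoint closed sets $C_1,C_2\subseteq[0,1]$ there is a set $D\subseteq M^{|y|}$, definable in $M$ with parameters from $M$, which contains $\{b\in M^{|y|}:\mu(\varphi(x,b))\in C_1\}$ and is disjoint from $\{b\in M^{|y|}:\mu(\varphi(x,b))\in C_2\}$. Here $\mu(\varphi(x,b))$ is the measure of the clopen set $\{p:\varphi(x,b)\in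 p\}$. 2. Let $G$ be an $M$-definable group, i.e. $G(M)\subseteq M^n$ and the graph of its group operation are definable in $M$ with parameters from $M$; for $N\succeq M$ let $G(N)$ be the group defined in $N$ by the same formulas. Call $G$ definably amenable, as computed in $N$, if there is a left-$G(N)$-invariant finitely additive probability measure on the algebra of all subsets of $G(N)$ that are definable in $N$ with parameters from $N$. If $G$ is definably amenable, as computed in some elementary extension of $M$ (for example in $M$ itself or in a monster model), then in every elementary extension $N'$ of $M$ (for example in $M$ itself or in a monster model) this is witnessed by an $M$-definable measure: there is a left-$G(N')$-invariant finitely additive probability measure $\nu$ on the algebra of all subsets of $G(N')$ definable in $N'$ with parameters from $N'$ such that for every $L$-formula $\varphi(x,y)$ and all disjoint closed $C_1,C_2\subseteq[0,1]$ there is a set $D\subseteq (N')^{|y|}$, definable in $N'$ with parameters from $M$, which contains $\{b\in (N')^{|y|}:\nu(G(N')\cap\varphi(N',b))\in C_1\}$ and is disjoint from $\{b\in (N')^{|y|}:\nu(G(N')\cap\varphi(N',b))\in C_2\}$. -/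

import Mathlib

open FirstOrder

universe u v w w₁ w₂

namespace NIPMeasure

/-- The formula `φ(x, y)` has NIP modulo `T`: for some `k`, no model of `T` contains
`a_i` (`i < k`) and `b_S` (`S ⊆ {0, …, k - 1}`) with `φ(a_i, b_S)` if and only if `i ∈ S`. -/
def FormulaNIP {L : FirstOrder.Language.{u, v}} (T : L.Theory) {n m : ℕ}
    (φ : L.Formula (Fin n ⊕ Fin m)) : Prop :=
  ∃ k : ℕ, ∀ N : FirstOrder.Language.Theory.ModelType.{u, v, max u v w} T,
    ¬ ∃ (a : Fin k → Fin n → N) (b : Set (Fin k) → Fin m → N),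
      ∀ (i : Fin k) (S : Set (Fin k)), φ.Realize (Sum.elim (a i) (b S)) ↔ i ∈ S

/-- The theory `T` is NIP: every formula has NIP modulo `T`.  (By Löwenheim–Skolem the universe
`max u v w` of the models is immaterial, since it contains that of the language.) -/
def TheoryNIP {L : FirstOrder.Language.{u, v}} (T : L.Theory) : Prop :=
  ∀ (n m : ℕ) (φ : L.Formula (Fin n ⊕ Fin m)), FormulaNIP.{u, v, w} T φ

section TypesOverM

variable (L : FirstOrder.Language.{u, v}) (M : Type w) [L.Structure M]

/-- `S_n(M)`: the space of complete types in `n` variables over the model `M`, i.e. complete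
types over the elementary diagram of `M`, with the Stone topology. -/
abbrev TypeSpace (n : ℕ) : Type _ :=
  (L.elementaryDiagram M).CompleteType (Fin n)

variable {L M}

/-- The formula `φ(x, b)` over `M` obtained by substituting the tuple `b` for `y` in
`φ(x, y)`. -/
def instFormula {n m : ℕ} (φ : L.Formula (Fin n ⊕ Fin m)) (b : Fin m → M) :
    L[[M]].Formula (Fin n) :=
  ((L.lhomWithConstants M).onFormula φ).subst
    (Sum.elim (fun i => FirstOrder.Language.Term.var i) (fun j => (L.con (b j)).term))

/-- The clopen subset `[φ(x, b)] = {p : φ(x, b) ∈ p}` of `S_n(M)`. -/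
def clopen {n m : ℕ} (φ : L.Formula (Fin n ⊕ Fin m)) (b : Fin m → M) :
    Set (TypeSpace L M n) :=
  {p | FirstOrder.Language.Formula.equivSentence (instFormula φ b) ∈ p}

/-- A type `p ∈ S_n(M)` is definable: for each `L`-formula `φ(x, y)` the set of `b` in `M` with
`φ(x, b) ∈ p` is definable in `M` with parameters from `M`. -/
def IsDefinableType {n : ℕ} (p : TypeSpace L M n) : Prop :=
  ∀ (m : ℕ) (φ : L.Formula (Fin n ⊕ Fin m)),
    (Set.univ : Set M).Definable L {b : Fin m → M | p ∈ clopen φ b}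

/-- A measure `μ` on `S_n(M)` is definable: for each `L`-formula `φ(x, y)` and all
disjoint closed `C₁, C₂ ⊆ [0, 1]`, the sets `{b : μ(φ(x, b)) ∈ C₁}` and `{b : μ(φ(x, b)) ∈ C₂}`
are separated by a set definable in `M` with parameters from `M`. -/
def IsDefinableMeasure {n : ℕ} [MeasurableSpace (TypeSpace L M n)]
    (μ : MeasureTheory.Measure (TypeSpace L M n)) : Prop :=
  ∀ (m : ℕ) (φ : L.Formula (Fin n ⊕ Fin m)) (C₁ C₂ : Set ℝ),
    C₁ ⊆ Set.Icc 0 1 → C₂ ⊆ Set.Icc 0 1 → IsClosed C₁ → IsClosed C₂ → Disjoint C₁ C₂ →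
    ∃ D : Set (Fin m → M), (Set.univ : Set M).Definable L D ∧
      {b | μ.real (clopen φ b) ∈ C₁} ⊆ D ∧ Disjoint D {b | μ.real (clopen φ b) ∈ C₂}

end TypesOverM

/-- An `M`-definable group: a subset of `M ^ n` defined by a formula `dom` with parameters in `M`
with a group law whose graph is defined by a formula `mul` with parameters in `M`.
The variables of `dom` and `mul` indexed by `M` stand for the parameters. -/
structure DefinableGroup (L : FirstOrder.Language.{u, v}) (M : Type w) [L.Structure M] (n : ℕ) where
  dom : L.Formula (M ⊕ Fin n)
  mul : L.Formula (M ⊕ (Fin n ⊕ (Fin n ⊕ Fin n)))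
  group : Group {g : Fin n → M // dom.Realize (Sum.elim id g)}
  realize_mul_iff : ∀ g h k : {g : Fin n → M // dom.Realize (Sum.elim id g)},
    mul.Realize (Sum.elim id (Sum.elim g.1 (Sum.elim h.1 k.1))) ↔ g * h = k

namespace DefinableGroup

variable {L : FirstOrder.Language.{u, v}} {M : Type w} [L.Structure M] {n : ℕ} (G : DefinableGroup L M n)
  {N : Type w₁} [L.Structure N] (f : M ↪ₑ[L] N)

/-- `G(N)`, for an elementary extension `f : M → N`. -/
def points : Set (Fin n → N) := {g | G.dom.Realize (Sum.elim f g)}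

/-- The left translate `g X`, computed in `G(N)`, where `g ∈ G(N)` and `X ⊆ G(N)`. -/
def leftTranslate (g : Fin n → N) (X : Set (Fin n → N)) : Set (Fin n → N) :=
  {z | z ∈ G.points f ∧ ∃ x ∈ X, G.mul.Realize (Sum.elim f (Sum.elim g (Sum.elim x z)))}

/-- `ν` is a left-invariant finitely additive probability measure on the algebra of all
subsets of `G(N)` that are definable in `N` with parameters from `N`.
(The values of `ν` on other sets are irrelevant.) -/
structure IsInvariantMeasure (ν : Set (Fin n → N) → ℝ) : Prop where
  nonneg : ∀ X ⊆ G.points f, (Set.univ : Set N).Definable L X → 0 ≤ ν X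
  total : ν (G.points f) = 1
  additive : ∀ X ⊆ G.points f, ∀ Y ⊆ G.points f, (Set.univ : Set N).Definable L X →
    (Set.univ : Set N).Definable L Y → Disjoint X Y → ν (X ∪ Y) = ν X + ν Y
  left_invariant : ∀ g ∈ G.points f, ∀ X ⊆ G.points f, (Set.univ : Set N).Definable L X →
    ν (G.leftTranslate f g X) = ν X

/-- `G` is definably amenable, as computed in `N`. -/
def IsDefinablyAmenable : Prop := ∃ ν : Set (Fin n → N) → ℝ, G.IsInvariantMeasure f ν

/-- A measure `ν` on the definable subsets of `G(N)` is `M`-definable: for each `L`-formula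
`φ(x, y)` and all disjoint closed `C₁, C₂ ⊆ [0, 1]`, the sets of `b` in `N` with
`ν(G(N) ∩ φ(N, b)) ∈ C₁`, resp. `∈ C₂`, are separated by a set definable in `N` with
parameters from `M`. -/
def IsDefinableOver (ν : Set (Fin n → N) → ℝ) : Prop :=
  ∀ (m : ℕ) (φ : L.Formula (Fin n ⊕ Fin m)) (C₁ C₂ : Set ℝ),
    C₁ ⊆ Set.Icc 0 1 → C₂ ⊆ Set.Icc 0 1 → IsClosed C₁ → IsClosed C₂ → Disjoint C₁ C₂ →
    ∃ D : Set (Fin m → N), (Set.range f).Definable L D ∧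
      {b | ν (G.points f ∩ {x | φ.Realize (Sum.elim x b)}) ∈ C₁} ⊆ D ∧
      Disjoint D {b | ν (G.points f ∩ {x | φ.Realize (Sum.elim x b)}) ∈ C₂}

end DefinableGroup

end NIPMeasure

/-!
The measure `μ` enters only through its values on the clopen sets `[φ(x, b)]`, where it is
finitely additive. By NIP the family of these sets shatters no `k` types: types over `M` are
approximated by tuples of `M` (`exists_typeOver_mem`), so shattered types would give shattered
tuples. Hence the `ε`-net theorem for families of finite VC dimension applies to the symmetric
differences of the sets `[φ(x, b)]` and `[φ(x, b')]`. It is proved by double sampling for finite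
probability spaces, with a length of the net which does not depend on the space
(`exists_net_length`); therefore nets for finite subfamilies give, by compactness of `S_n(M)`, a
net `p_1, …, p_N` of types for the whole family (`IsFinAddProb.exists_points_abs_sub_lt`). So
`μ(φ(x, b))` is determined up to `ε` by the set of those `i` with `φ(x, b) ∈ p_i`, which is a
definable property of `b` as the types `p_i` are definable. This gives the separating sets
(`exists_definable_separating`).

For the second part, let `ν₀` be an invariant measure on `G(N)`. By compactness the elementary
extension `N'` of `M` is a limit of maps `s : N' → M` fixing `M`, along an ultrafilter for which
truth in `N'` is truth at almost all `s` (`exists_ultrafilter_leftInverse`). Put `ν(φ(N', c)) =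
lim_s ν₀(φ(N, s c))`. Additivity and invariance of `ν` follow from those of `ν₀`, since
disjointness of two definable sets and being a translate are expressed by formulas. The separation
property holds for the values `ν₀(φ(N, b))` with `b` in `M`, because `ν₀` is a measure on a set
mapped to `S_n(M)` by taking types; it passes to the limit after a slight thickening of the two
closed sets.
-/

namespace NIPMeasure

/-! ### Nets for families of finite VC dimension on finite probability spaces -/

section Nets

open Finset

/-- The family `F` shatters some `k` points: every subset of the points is cut out by a member. -/
def ShattersPoints {X β : Type*} (F : β → Set X) (k : ℕ) : Prop :=
  ∃ (a : Fin k → X) (b : Set (Fin k) → β), ∀ i S, a i ∈ F (b S) ↔ i ∈ S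

open Classical in
/-- The sets of indices traced out on the tuple `z` by the members of the family `F`. -/
noncomputable def traces {X β J : Type*} [Fintype J] (F : β → Set X) (z : J → X) :
    Finset (Finset J) :=
  {t | ∃ b, ∀ j, j ∈ t ↔ z j ∈ F b}

theorem card_traces_le {X β J : Type*} [Fintype J] {F : β → Set X} {k : ℕ}
    (hF : ¬ ShattersPoints F k) (z : J → X) :
    (traces F z).card ≤ (k + 1) * (Fintype.card J + 1) ^ k := by
  classical
  have hvc : (traces F z).vcDim ≤ k := by
    refine Finset.sup_le fun s hs => ?_
    rw [mem_shatterer] at hs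
    by_contra! hk
    obtain ⟨s', hs', hcard⟩ := exists_subset_card_eq hk.le
    have hsh := hs.mono_right hs'
    let e := (s'.equivFinOfCardEq hcard).symm
    have key : ∀ S : Set (Fin k), ∃ b, ∀ i, z (e i) ∈ F b ↔ i ∈ S := by
      intro S
      obtain ⟨u, hu, hut⟩ := hsh (t := s'.filter fun j => ∃ i ∈ S, (e i : J) = j)
        (filter_subset _ _)
      simp only [traces, mem_filter, mem_univ, true_and] at hu
      obtain ⟨b, hb⟩ := hu
      refine ⟨b, fun i => ?_⟩
      have h1 := Finset.ext_iff.1 hut (e i)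
      simp only [mem_inter, mem_filter, (e i).2, true_and] at h1
      rw [← hb, h1]
      constructor
      · rintro ⟨i', hi', h⟩
        rwa [← e.injective (Subtype.ext h)]
      · exact fun h => ⟨i, h, rfl⟩
    choose b hb using key
    exact hF ⟨fun i => z (e i), b, fun i S => hb S i⟩
  calc (traces F z).card ≤ (traces F z).shatterer.card := card_le_card_shatterer _
    _ ≤ ∑ i ∈ Iic (traces F z).vcDim, (Fintype.card J).choose i := card_shatterer_le_sum_vcDim
    _ ≤ ∑ i ∈ Iic k, (Fintype.card J + 1) ^ k := by
        refine (sum_le_sum_of_subset (Iic_subset_Iic.2 hvc)).trans (sum_le_sum fun i hi => ?_)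
        calc (Fintype.card J).choose i ≤ (Fintype.card J) ^ i := Nat.choose_le_pow _ _
          _ ≤ (Fintype.card J + 1) ^ i := Nat.pow_le_pow_left (Nat.le_succ _) _
          _ ≤ _ := Nat.pow_le_pow_right (Nat.succ_pos _) (mem_Iic.1 hi)
    _ = _ := by simp

/-- The permutation of two samples of length `m` which exchanges the `i`-th points of the samples
whenever `σ i` holds. -/
def swapSamples {m : ℕ} (σ : Fin m → Bool) : Equiv.Perm (Fin m ⊕ Fin m) :=
  Function.Involutive.toPerm
    (Sum.elim (fun i => if σ i then Sum.inr i else Sum.inl i)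
      (fun i => if σ i then Sum.inl i else Sum.inr i))
    (by rintro (i | i) <;> cases h : σ i <;> simp [h])

theorem swapSamples_inl {m : ℕ} (σ : Fin m → Bool) (i : Fin m) :
    swapSamples σ (Sum.inl i) = if σ i then Sum.inr i else Sum.inl i := rfl

theorem swapSamples_inr {m : ℕ} (σ : Fin m → Bool) (i : Fin m) :
    swapSamples σ (Sum.inr i) = if σ i then Sum.inl i else Sum.inr i := rfl

/-- If the exchanges are chosen at random, the set `t` avoids the first sample and meets the second
one in at least `h` places with probability at most `2 ^ (-h)`: the exchanges in these places are
forced. -/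
theorem card_swapSamples_le {m : ℕ} (t : Finset (Fin m ⊕ Fin m)) (h : ℕ) :
    (univ.filter fun σ : Fin m → Bool => (∀ i, swapSamples σ (Sum.inl i) ∉ t) ∧
      h ≤ (univ.filter fun i => swapSamples σ (Sum.inr i) ∈ t).card).card * 2 ^ h ≤ 2 ^ m := by
  classical
  set A := univ.filter fun σ : Fin m → Bool => (∀ i, swapSamples σ (Sum.inl i) ∉ t) ∧
      h ≤ (univ.filter fun i => swapSamples σ (Sum.inr i) ∈ t).card with hA
  rcases A.eq_empty_or_nonempty with h0 | ⟨σ₀, hσ₀⟩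
  · simp [h0]
  set I := univ.filter fun i => swapSamples σ₀ (Sum.inr i) ∈ t with hI
  have hhI : h ≤ I.card := (mem_filter.1 hσ₀).2.2
  have hsub : A ⊆ Fintype.piFinset fun i => if i ∈ I then {σ₀ i} else univ := by
    intro σ hσ
    rw [Fintype.mem_piFinset]
    intro i
    split_ifs with hi
    · rw [mem_singleton]
      by_contra hne
      refine (mem_filter.1 hσ).2.1 i ?_
      have hi' := (mem_filter.1 hi).2
      have : swapSamples σ (Sum.inl i) = swapSamples σ₀ (Sum.inr i) := by
        revert hne
        cases h1 : σ i <;> cases h2 : σ₀ i <;> simp [swapSamples_inl, swapSamples_inr, h1, h2]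
      rwa [this]
    · exact mem_univ _
  have hcard : A.card ≤ 2 ^ (m - I.card) := by
    refine (card_le_card hsub).trans ?_
    rw [Fintype.card_piFinset]
    have : ∀ i, (if i ∈ I then ({σ₀ i} : Finset Bool) else univ).card = if i ∈ I then 1 else 2 := by
      intro i; split_ifs <;> simp
    simp_rw [this]
    rw [prod_ite]
    simp only [prod_const, one_pow, one_mul]
    refine Nat.pow_le_pow_right two_pos (le_of_eq ?_)
    have h1 := card_filter_add_card_filter_not (s := (univ : Finset (Fin m))) (fun i => i ∈ I)
    simp only [filter_mem_eq_inter, univ_inter, card_univ, Fintype.card_fin] at h1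
    omega
  have hIm : I.card ≤ m := by simpa using card_le_univ I
  calc A.card * 2 ^ h ≤ 2 ^ (m - I.card) * 2 ^ I.card :=
        Nat.mul_le_mul hcard (Nat.pow_le_pow_right two_pos hhI)
    _ = 2 ^ m := by rw [← pow_add]; congr 1; omega

variable {Ω : Type*} [Fintype Ω] {w : Ω → ℝ}

theorem sum_prod_mul_apply (hw1 : ∑ ω, w ω = 1) {m : ℕ} (g : Ω → ℝ) (i₀ : Fin m) :
    ∑ y : Fin m → Ω, (∏ i, w (y i)) * g (y i₀) = ∑ ω, w ω * g ω := by
  classical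
  have h := Finset.prod_univ_sum (fun _ : Fin m => (univ : Finset Ω))
    (fun i ω => w ω * if i = i₀ then g ω else 1)
  rw [Fintype.piFinset_univ] at h
  calc _ = ∑ y : Fin m → Ω, ∏ i, (w (y i) * if i = i₀ then g (y i) else 1) := by
        refine sum_congr rfl fun y _ => ?_
        rw [prod_mul_distrib]
        congr 1
        rw [prod_ite_eq' univ i₀ (fun i => g (y i))]
        simp
    _ = ∏ i : Fin m, ∑ ω, (w ω * if i = i₀ then g ω else 1) := h.symm
    _ = ∏ i : Fin m, (if i = i₀ then ∑ ω, w ω * g ω else 1) := by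
        refine prod_congr rfl fun i _ => ?_
        split_ifs
        · rfl
        · simpa using hw1
    _ = _ := by rw [prod_ite_eq' univ i₀ (fun _ => ∑ ω, w ω * g ω)]; simp

theorem sum_prod_eq_one (hw1 : ∑ ω, w ω = 1) (J : Type*) [Fintype J] [DecidableEq J] :
    ∑ z : J → Ω, ∏ j, w (z j) = 1 := by
  have h := Finset.prod_univ_sum (fun _ : J => (univ : Finset Ω)) (fun _ ω => w ω)
  rw [Fintype.piFinset_univ] at h
  rw [← h]
  simp [hw1]

open Classical in
/-- A random sample of length `m` meets a set of measure at least `ε` in `ε m / 2` places with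
probability at least `ε / 2`, by Markov's inequality for the number of misses. -/
theorem half_le_sum_prod_ite (hw : ∀ ω, 0 ≤ w ω) (hw1 : ∑ ω, w ω = 1) {ε : ℝ} {E : Set Ω}
    (hE : ε ≤ ∑ ω with ω ∈ E, w ω) {m h : ℕ} (hm : 0 < m) (hh : 2 * (h : ℝ) ≤ ε * m) :
    ε / 2 ≤ ∑ y : Fin m → Ω, (∏ i, w (y i)) *
      if h ≤ (univ.filter fun i => y i ∈ E).card then 1 else 0 := by
  have hcount : ∑ y : Fin m → Ω, (∏ i, w (y i)) * ((univ.filter fun i => y i ∈ E).card : ℝ)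
      = m * ∑ ω with ω ∈ E, w ω := by
    have : ∀ y : Fin m → Ω, ((univ.filter fun i => y i ∈ E).card : ℝ)
        = ∑ i, (fun ω => if ω ∈ E then (1 : ℝ) else 0) (y i) := by
      intro y; simp
    simp_rw [this, mul_sum]
    rw [sum_comm]
    simp_rw [sum_prod_mul_apply hw1 (fun ω => if ω ∈ E then (1 : ℝ) else 0)]
    simp [sum_filter, mul_sum]
  have hle : ∑ y : Fin m → Ω, (∏ i, w (y i)) * ((univ.filter fun i => y i ∈ E).card : ℝ)
      ≤ ∑ y : Fin m → Ω, (∏ i, w (y i)) *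
        (h + m * if h ≤ (univ.filter fun i => y i ∈ E).card then 1 else 0) := by
    refine sum_le_sum fun y _ => mul_le_mul_of_nonneg_left ?_ (prod_nonneg fun i _ => hw _)
    split_ifs with hc
    · have : (univ.filter fun i => y i ∈ E).card ≤ m := by
        simpa using card_le_univ (univ.filter fun i => y i ∈ E)
      have : ((univ.filter fun i => y i ∈ E).card : ℝ) ≤ m := by exact_mod_cast this
      have : (0 : ℝ) ≤ h := Nat.cast_nonneg _
      linarith
    · have : (((univ.filter fun i => y i ∈ E).card : ℕ) : ℝ) ≤ h := by
        exact_mod_cast (not_le.1 hc).le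
      linarith
  simp_rw [mul_add, sum_add_distrib, mul_left_comm _ (m : ℝ), ← sum_mul, ← mul_sum] at hle
  rw [hcount, sum_prod_eq_one hw1, one_mul] at hle
  have hm' : (0 : ℝ) < m := by exact_mod_cast hm
  have h3 : ε * m ≤ h + m * ∑ y : Fin m → Ω, (∏ i, w (y i)) *
      (if h ≤ (univ.filter fun i => y i ∈ E).card then 1 else 0) :=
    le_trans (by rw [mul_comm]; exact mul_le_mul_of_nonneg_left hE hm'.le) hle
  refine le_of_mul_le_mul_left ?_ hm'
  linarith

open Classical in
/-- The double sampling argument.  If every sample `x` of length `m` missed some set `E` of measure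
at least `ε`, then a second sample `y` would meet this `E` often.  Exchanging points between
`x` and `y` at random shows that this is unlikely, as there are few traces on the two samples. -/
theorem exists_sample_of_card_traces {β : Type*} {F : β → Set Ω} (hw : ∀ ω, 0 ≤ w ω)
    (hw1 : ∑ ω, w ω = 1) {ε : ℝ} {m h K : ℕ} (hm : 0 < m) (hh : 2 * (h : ℝ) ≤ ε * m)
    (hK : ∀ z : Fin m ⊕ Fin m → Ω, (traces F z).card ≤ K) (hKh : (K : ℝ) ^ 2 < ε / 2 * 2 ^ h) :
    ∃ x : Fin m → Ω, ∀ b b', ε ≤ ∑ ω with ω ∈ symmDiff (F b) (F b'), w ω →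
      ∃ i, x i ∈ symmDiff (F b) (F b') := by
  by_contra! hcon
  choose b b' hbig hmiss using hcon
  let W : (Fin m ⊕ Fin m → Ω) → ℝ := fun z => ∏ j, w (z j)
  have hW : ∀ z, 0 ≤ W z := fun z => prod_nonneg fun _ _ => hw _
  -- Some symmetric difference misses the first half of `z` and meets the second half often.
  let Q : (Fin m ⊕ Fin m → Ω) → Prop := fun z => ∃ b b',
    (∀ i, z (Sum.inl i) ∉ symmDiff (F b) (F b')) ∧
    h ≤ (univ.filter fun i => z (Sum.inr i) ∈ symmDiff (F b) (F b')).card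
  have h1 : ε / 2 ≤ ∑ z, W z * if Q z then 1 else 0 := by
    rw [← (Equiv.sumArrowEquivProdArrow (Fin m) (Fin m) Ω).symm.sum_comp, Fintype.sum_prod_type]
    calc ε / 2 = ∑ x : Fin m → Ω, (∏ i, w (x i)) * (ε / 2) := by
          rw [← sum_mul, sum_prod_eq_one hw1, one_mul]
      _ ≤ _ := by
          refine sum_le_sum fun x _ => ?_
          refine (mul_le_mul_of_nonneg_left (half_le_sum_prod_ite hw hw1 (hbig x) hm hh)
            (prod_nonneg fun i _ => hw _)).trans ?_
          rw [mul_sum]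
          refine sum_le_sum fun y _ => ?_
          simp only [W, Fintype.prod_sum_type, Equiv.sumArrowEquivProdArrow_symm_apply_inl,
            Equiv.sumArrowEquivProdArrow_symm_apply_inr]
          rw [mul_assoc]
          refine mul_le_mul_of_nonneg_left (mul_le_mul_of_nonneg_left ?_
            (prod_nonneg fun i _ => hw _)) (prod_nonneg fun i _ => hw _)
          split_ifs with c1 c2
          · exact le_rfl
          · exact absurd ⟨b x, b' x, by simpa using hmiss x, by convert c1; rfl⟩ c2
          · exact zero_le_one
          · exact le_rfl
  have h2 : ∀ σ : Fin m → Bool, ∑ z, W z * (if Q z then 1 else 0) =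
      ∑ z, W z * if Q (z ∘ swapSamples σ) then 1 else 0 := by
    intro σ
    rw [← (Equiv.arrowCongr (swapSamples σ).symm (Equiv.refl Ω)).sum_comp]
    refine sum_congr rfl fun z _ => ?_
    have : W ((Equiv.arrowCongr (swapSamples σ).symm (Equiv.refl Ω)) z) = W z := by
      simp only [W, Equiv.arrowCongr_apply, Equiv.symm_symm, Equiv.coe_refl, Function.comp_apply,
        id]
      exact Equiv.prod_comp (swapSamples σ) fun j => w (z j)
    rw [this]
    rfl
  -- For a fixed `z`, a union bound over the traces of symmetric differences, of which there are at
  -- most `K ^ 2`.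
  have h3 : ∀ z : Fin m ⊕ Fin m → Ω,
      (univ.filter fun σ => Q (z ∘ swapSamples σ)).card * 2 ^ h ≤ K ^ 2 * 2 ^ m := by
    intro z
    let 𝒯 := ((traces F z) ×ˢ (traces F z)).image fun p => symmDiff p.1 p.2
    have h𝒯 : 𝒯.card ≤ K ^ 2 := by
      refine card_image_le.trans ?_
      rw [card_product, sq]
      exact Nat.mul_le_mul (hK z) (hK z)
    have hsub : (univ.filter fun σ => Q (z ∘ swapSamples σ)) ⊆
        𝒯.biUnion fun t => univ.filter fun σ : Fin m → Bool =>
          (∀ i, swapSamples σ (Sum.inl i) ∉ t) ∧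
          h ≤ (univ.filter fun i => swapSamples σ (Sum.inr i) ∈ t).card := by
      intro σ hσ
      obtain ⟨b, b', hl, hr⟩ := (mem_filter.1 hσ).2
      rw [mem_biUnion]
      refine ⟨symmDiff (univ.filter fun j => z j ∈ F b) (univ.filter fun j => z j ∈ F b'),
        mem_image.2 ⟨⟨univ.filter fun j => z j ∈ F b, univ.filter fun j => z j ∈ F b'⟩, ?_, rfl⟩,
        ?_⟩
      · simp only [mem_product, traces, mem_filter, mem_univ, true_and]
        exact ⟨⟨b, fun _ => Iff.rfl⟩, ⟨b', fun _ => Iff.rfl⟩⟩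
      · have hmem : ∀ j, j ∈ symmDiff (univ.filter fun j => z j ∈ F b)
            (univ.filter fun j => z j ∈ F b') ↔ z j ∈ symmDiff (F b) (F b') := by
          intro j
          simp [Finset.mem_symmDiff, Set.mem_symmDiff]
        simp only [mem_filter, mem_univ, true_and, hmem]
        exact ⟨hl, hr⟩
    calc _ ≤ (∑ t ∈ 𝒯, _) * 2 ^ h :=
          Nat.mul_le_mul_right _ ((card_le_card hsub).trans card_biUnion_le)
      _ ≤ ∑ t ∈ 𝒯, 2 ^ m := by
          rw [sum_mul]
          exact sum_le_sum fun t _ => card_swapSamples_le t h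
      _ ≤ _ := by
          rw [sum_const, smul_eq_mul]
          exact Nat.mul_le_mul_right _ h𝒯
  have h4 : (2 : ℝ) ^ m * (ε / 2) * 2 ^ h ≤ K ^ 2 * 2 ^ m := by
    calc (2 : ℝ) ^ m * (ε / 2) * 2 ^ h
        ≤ (∑ σ : Fin m → Bool, ∑ z, W z * if Q (z ∘ swapSamples σ) then 1 else 0) * 2 ^ h := by
          refine mul_le_mul_of_nonneg_right ?_ (by positivity)
          simp_rw [← h2, sum_const, card_univ, Fintype.card_fun, Fintype.card_bool,
            Fintype.card_fin, nsmul_eq_mul]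
          push_cast
          exact mul_le_mul_of_nonneg_left h1 (by positivity)
      _ = ∑ z, W z * (((univ.filter fun σ => Q (z ∘ swapSamples σ)).card * 2 ^ h : ℕ) : ℝ) := by
          rw [sum_comm, sum_mul]
          refine sum_congr rfl fun z _ => ?_
          rw [← mul_sum]
          push_cast
          rw [mul_assoc, Finset.sum_boole]
      _ ≤ ∑ z, W z * ((K ^ 2 * 2 ^ m : ℕ) : ℝ) :=
          sum_le_sum fun z _ => mul_le_mul_of_nonneg_left (by exact_mod_cast h3 z) (hW z)
      _ = _ := by
          rw [← sum_mul, sum_prod_eq_one hw1, one_mul]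
          push_cast
          rfl
  have h5 : (0 : ℝ) < 2 ^ m := by positivity
  nlinarith

open Classical in
/-- **The `ε`-net theorem** for symmetric differences: the length of the net depends only on `ε` and
on the number of points which cannot be shattered. -/
theorem exists_net_length (k : ℕ) {ε : ℝ} (hε : 0 < ε) : ∃ m : ℕ,
    ∀ (Ω : Type*) [Fintype Ω] (β : Type*) (F : β → Set Ω) (w : Ω → ℝ), ¬ ShattersPoints F k →
      (∀ ω, 0 ≤ w ω) → ∑ ω, w ω = 1 →
      ∃ x : Fin m → Ω, ∀ b b', ε ≤ ∑ ω with ω ∈ symmDiff (F b) (F b'), w ω →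
        ∃ i, x i ∈ symmDiff (F b) (F b') := by
  obtain ⟨q, hq⟩ := exists_nat_ge (2 / ε)
  have hq0 : (0 : ℝ) < q := lt_of_lt_of_le (by positivity) hq
  -- Samples of length `m = q h` give at most `K h` traces, and `K h ^ 2 = o (2 ^ h)`.
  let K : ℕ → ℕ := fun h => (k + 1) * (2 * (q * h) + 1) ^ k
  have hlim : Filter.Tendsto (fun h : ℕ => (K h : ℝ) ^ 2 / 2 ^ h) Filter.atTop (nhds 0) := by
    have h0 := (tendsto_pow_const_div_const_pow_of_one_lt (k * 2) (one_lt_two (α := ℝ))).const_mul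
      (((k + 1 : ℝ) * (2 * q + 1) ^ k) ^ 2)
    rw [mul_zero] at h0
    refine squeeze_zero' (Filter.Eventually.of_forall fun h => by positivity) ?_ h0
    filter_upwards [Filter.eventually_ge_atTop 1] with h hh
    rw [← mul_div_assoc]
    refine div_le_div_of_nonneg_right ?_ (by positivity)
    have hh' : (1 : ℝ) ≤ h := by exact_mod_cast hh
    have : (K h : ℝ) ≤ ((k + 1 : ℝ) * (2 * q + 1) ^ k) * h ^ k := by
      simp only [K]
      push_cast
      rw [mul_assoc, ← mul_pow]
      gcongr
      nlinarith
    calc (K h : ℝ) ^ 2 ≤ (((k + 1 : ℝ) * (2 * q + 1) ^ k) * h ^ k) ^ 2 := by gcongr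
      _ = _ := by rw [mul_pow _ ((h : ℝ) ^ k), pow_mul]
  obtain ⟨h, hh1, hh2⟩ := ((hlim.eventually (gt_mem_nhds (half_pos hε))).and
    (Filter.eventually_ge_atTop 1)).exists
  refine ⟨q * h, fun Ω _ β F w hF hw hw1 => ?_⟩
  refine exists_sample_of_card_traces (h := h) (K := K h) hw hw1 ?_ ?_ ?_ ?_
  · exact Nat.mul_pos (by exact_mod_cast hq0) hh2
  · have : 2 ≤ ε * q := by rwa [div_le_iff₀' hε] at hq
    push_cast
    have hh' : (0 : ℝ) ≤ h := Nat.cast_nonneg _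
    nlinarith
  · intro z
    refine (card_traces_le hF z).trans (le_of_eq ?_)
    simp [K, two_mul]
  · rwa [div_lt_iff₀ (by positivity)] at hh1

end Nets

/-! ### Finitely additive measures -/

section FinitelyAdditive

open MeasureTheory

/-- `μ` restricts to a finitely additive probability measure on the algebra `C` of sets. -/
structure IsFinAddProb {X : Type*} (C : Set (Set X)) (μ : Set X → ℝ) : Prop where
  isSetAlgebra : IsSetAlgebra C
  nonneg : ∀ A ∈ C, 0 ≤ μ A
  univ : μ Set.univ = 1
  union : ∀ A ∈ C, ∀ B ∈ C, Disjoint A B → μ (A ∪ B) = μ A + μ B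

namespace IsFinAddProb

variable {X : Type*} {C : Set (Set X)} {μ : Set X → ℝ} (hμ : IsFinAddProb C μ)
include hμ

theorem empty : μ ∅ = 0 := by
  have h := hμ.union ∅ hμ.isSetAlgebra.empty_mem ∅ hμ.isSetAlgebra.empty_mem
    (Set.disjoint_empty _)
  rw [Set.union_empty] at h
  linarith

theorem mono {A B : Set X} (hA : A ∈ C) (hB : B ∈ C) (h : A ⊆ B) : μ A ≤ μ B := by
  have hd := hμ.isSetAlgebra.sdiff_mem hB hA
  have h1 := hμ.union A hA (B \ A) hd Set.disjoint_sdiff_right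
  rw [Set.union_sdiff_cancel h] at h1
  linarith [hμ.nonneg _ hd]

theorem mem_Icc {A : Set X} (hA : A ∈ C) : μ A ∈ Set.Icc (0 : ℝ) 1 :=
  ⟨hμ.nonneg A hA, hμ.univ ▸ hμ.mono hA hμ.isSetAlgebra.univ_mem (Set.subset_univ _)⟩

theorem le_add_symmDiff {A B : Set X} (hA : A ∈ C) (hB : B ∈ C) :
    μ A ≤ μ B + μ (symmDiff A B) := by
  have hs := hμ.isSetAlgebra
  have hd := hs.sdiff_mem hA hB
  have hd' := hs.sdiff_mem hB hA
  calc μ A ≤ μ (B ∪ (A \ B)) := by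
        refine hμ.mono hA (hs.union_mem hB hd) ?_
        rw [Set.union_sdiff_self]
        exact Set.subset_union_right
    _ = μ B + μ (A \ B) := hμ.union _ hB _ hd Set.disjoint_sdiff_right
    _ ≤ _ := by
        gcongr
        exact hμ.mono hd (hs.union_mem hd hd') Set.subset_union_left

theorem abs_sub_le_symmDiff {A B : Set X} (hA : A ∈ C) (hB : B ∈ C) :
    |μ A - μ B| ≤ μ (symmDiff A B) := by
  have h1 := hμ.le_add_symmDiff hA hB
  have h2 := hμ.le_add_symmDiff hB hA
  rw [symmDiff_comm] at h2
  rw [abs_le]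
  constructor <;> linarith

theorem preimage_finset {Ω : Type*} {π : X → Ω} (hπ : ∀ ω, π ⁻¹' {ω} ∈ C) (S : Finset Ω) :
    π ⁻¹' S ∈ C ∧ μ (π ⁻¹' S) = ∑ ω ∈ S, μ (π ⁻¹' {ω}) := by
  classical
  induction S using Finset.induction_on with
  | empty => simpa using ⟨hμ.isSetAlgebra.empty_mem, hμ.empty⟩
  | insert ω S hω ih =>
    rw [Finset.coe_insert, Set.insert_eq, Set.preimage_union, Finset.sum_insert hω, ← ih.2]
    refine ⟨hμ.isSetAlgebra.union_mem (hπ ω) ih.1, hμ.union _ (hπ ω) _ ih.1 ?_⟩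
    refine Disjoint.preimage _ ?_
    simpa using hω

/-- `ε`-nets, of a length which works for all finite subfamilies: a finite subfamily generates a
finite algebra, to whose set of atoms the `ε`-net theorem for finite probability spaces applies. -/
theorem exists_net_finset {β : Type*} {F : β → Set X} (hFC : ∀ b, F b ∈ C) {k : ℕ}
    (hF : ¬ ShattersPoints F k) {ε : ℝ} (hε : 0 < ε) : ∃ N : ℕ, ∀ B : Finset β,
      ∃ x : Fin N → X, ∀ b ∈ B, ∀ b' ∈ B, ε ≤ μ (symmDiff (F b) (F b')) →
        ∃ i, x i ∈ symmDiff (F b) (F b') := by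
  classical
  obtain ⟨N, hN⟩ := exists_net_length k hε
  refine ⟨N, fun B => ?_⟩
  -- The elements of `Ω` are the nonempty atoms of the algebra generated by the `F b` with `b ∈ B`.
  let pat : X → B → Prop := fun x b => x ∈ F b
  let Ω := Set.range pat
  have : Fintype Ω := Fintype.ofFinite _
  let π : X → Ω := Set.rangeFactorization pat
  have hπs : Function.Surjective π := Set.rangeFactorization_surjective
  let F' : B → Set Ω := fun b => {ω | ω.1 b}
  have hFF' : ∀ b : B, F b = π ⁻¹' F' b := fun b => rfl
  have hπ : ∀ ω, π ⁻¹' {ω} ∈ C := by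
    intro ω
    have : π ⁻¹' {ω} = ⋂ b ∈ (Finset.univ : Finset B), if ω.1 b then F b else (F b)ᶜ := by
      ext x
      simp only [Set.mem_preimage, Set.mem_singleton_iff, Set.mem_iInter, Finset.mem_univ,
        forall_true_left, Subtype.ext_iff, funext_iff]
      refine forall_congr' fun b => ?_
      change (x ∈ F b) = ω.1 b ↔ _
      by_cases h : ω.1 b <;> simp [h]
    rw [this]
    refine hμ.isSetAlgebra.biInter_mem _ fun b _ => ?_
    split_ifs
    · exact hFC _
    · exact hμ.isSetAlgebra.compl_mem (hFC _)
  have hsum : ∀ S : Set Ω, μ (π ⁻¹' S) = ∑ ω with ω ∈ S, μ (π ⁻¹' {ω}) := by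
    intro S
    rw [← (hμ.preimage_finset hπ _).2]
    simp
  have hF' : ¬ ShattersPoints F' k := by
    rintro ⟨a, b, hab⟩
    choose y hy using fun i => hπs (a i)
    refine hF ⟨y, fun S => b S, fun i S => ?_⟩
    rw [← hab, hFF', Set.mem_preimage, hy]
  have hw1 : ∑ ω, μ (π ⁻¹' {ω}) = 1 := by
    have := hsum Set.univ
    simpa [hμ.univ] using this.symm
  obtain ⟨x, hx⟩ := hN Ω B F' (fun ω => μ (π ⁻¹' {ω})) hF' (fun ω => hμ.nonneg _ (hπ ω)) hw1
  choose y hy using fun i => hπs (x i)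
  refine ⟨y, fun b hb b' hb' h => ?_⟩
  have hbig : μ (symmDiff (F b) (F b')) =
      ∑ ω with ω ∈ symmDiff (F' ⟨b, hb⟩) (F' ⟨b', hb'⟩), μ (π ⁻¹' {ω}) :=
    hsum (symmDiff (F' ⟨b, hb⟩) (F' ⟨b', hb'⟩))
  rw [hbig] at h
  obtain ⟨i, hi⟩ := hx ⟨b, hb⟩ ⟨b', hb'⟩ (by convert h)
  refine ⟨i, ?_⟩
  rw [← hy i] at hi
  exact hi

/-- A family of clopen sets of a compact space, of which no `k` points are shattered, and
a finitely additive measure on a set mapped to the space: the measure of a member of the family is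
determined up to `ε` by which ones of finitely many suitable points it contains. -/
theorem exists_points_abs_sub_lt {Y β : Type*} [TopologicalSpace Y] [CompactSpace Y]
    {K : β → Set Y} (hK : ∀ b, IsClopen (K b)) {τ : X → Y} (hKC : ∀ b, τ ⁻¹' K b ∈ C) {k : ℕ}
    (hk : ¬ ShattersPoints K k) {ε : ℝ} (hε : 0 < ε) : ∃ (N : ℕ) (p : Fin N → Y),
      ∀ b b', (∀ i, p i ∈ K b ↔ p i ∈ K b') → |μ (τ ⁻¹' K b) - μ (τ ⁻¹' K b')| < ε := by
  classical
  have hk' : ¬ ShattersPoints (fun b => τ ⁻¹' K b) k := by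
    rintro ⟨a, b, hab⟩
    exact hk ⟨fun i => τ (a i), b, hab⟩
  obtain ⟨N, hN⟩ := hμ.exists_net_finset hKC hk' hε
  let big : Set (β × β) := {q | ε ≤ μ (symmDiff (τ ⁻¹' K q.1) (τ ⁻¹' K q.2))}
  let Z : big → Set (Fin N → Y) := fun q => {p | ∃ i, p i ∈ symmDiff (K q.1.1) (K q.1.2)}
  have hZ : ∀ q, IsClosed (Z q) := by
    intro q
    have : Z q = ⋃ i, (fun p : Fin N → Y => p i) ⁻¹' symmDiff (K q.1.1) (K q.1.2) := by
      ext p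
      simp only [Set.mem_iUnion]
      rfl
    rw [this]
    refine isClosed_iUnion_of_finite fun i => IsClosed.preimage (continuous_apply i) ?_
    exact (((hK _).diff (hK _)).union ((hK _).diff (hK _))).1
  have hne : (⋂ q, Z q).Nonempty := by
    refine CompactSpace.iInter_nonempty hZ fun Q => ?_
    obtain ⟨x, hx⟩ := hN (Q.image (fun q => q.1.1) ∪ Q.image fun q => q.1.2)
    refine ⟨fun i => τ (x i), Set.mem_iInter₂.2 fun q hq => ?_⟩
    exact hx q.1.1 (Finset.mem_union_left _ (Finset.mem_image_of_mem _ hq)) q.1.2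
      (Finset.mem_union_right _ (Finset.mem_image_of_mem (fun q : big => q.1.2) hq)) q.2
  obtain ⟨p, hp⟩ := hne
  refine ⟨N, p, fun b b' h => ?_⟩
  by_contra! hge
  obtain ⟨i, hi⟩ := Set.mem_iInter.1 hp
    ⟨(b, b'), hge.trans (hμ.abs_sub_le_symmDiff (hKC b) (hKC b'))⟩
  rcases hi with hi | hi
  · exact hi.2 ((h i).1 hi.1)
  · exact hi.2 ((h i).2 hi.1)

end IsFinAddProb

end FinitelyAdditive

open FirstOrder.Language Filter Topology

/-! ### The space of types over a model -/

section Types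

variable {L : FirstOrder.Language.{u, v}} {M : Type w} [L.Structure M] {n m : ℕ}

theorem isClopen_clopen (φ : L.Formula (Fin n ⊕ Fin m)) (b : Fin m → M) : IsClopen (clopen φ b) :=
  CompleteType.isClopen_typesWith _

theorem model_elementaryDiagram {N : Type w₁} [L.Structure N] (f : M ↪ₑ[L] N) :
    letI := constantsOn.structure f
    N ⊨ L.elementaryDiagram M := by
  let := constantsOn.structure f
  refine (Theory.model_iff _).2 fun φ hφ => ?_
  rw [mem_completeTheory] at hφ
  have h1 := (Formula.realize_equivSentence_symm_con M φ).2 hφ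
  exact (Formula.realize_equivSentence_symm_con N φ).1 ((f.map_formula _ _).2 h1)

variable [Nonempty M]

/-- The type over `M` of a tuple in an elementary extension `f : M → N`. -/
def typeOver {N : Type w₁} [L.Structure N] (f : M ↪ₑ[L] N) (a : Fin n → N) : TypeSpace L M n :=
  letI := constantsOn.structure f
  haveI := model_elementaryDiagram f
  haveI : Nonempty N := ‹Nonempty M›.map f
  (L.elementaryDiagram M).typeOf a

theorem typeOver_mem_clopen {N : Type w₁} [L.Structure N] (f : M ↪ₑ[L] N) (a : Fin n → N)
    (φ : L.Formula (Fin n ⊕ Fin m)) (b : Fin m → M) :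
    typeOver f a ∈ clopen φ b ↔ φ.Realize (Sum.elim a (f ∘ b)) := by
  let := constantsOn.structure f
  have := model_elementaryDiagram f
  have : Nonempty N := ‹Nonempty M›.map f
  refine (Theory.CompleteType.formula_mem_typeOf (T := L.elementaryDiagram M)).trans ?_
  unfold instFormula Formula.Realize
  rw [BoundedFormula.realize_subst]
  refine (LHom.realize_onFormula (L.lhomWithConstants M) φ).trans (iff_of_eq ?_)
  congr 1
  ext (i | j)
  · rfl
  · simp
    rfl

/-- Types realized in `M` are dense in `S_n(M)`. -/
theorem exists_typeOver_mem {U : Set (TypeSpace L M n)} (hU : IsOpen U) (hne : U.Nonempty) :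
    ∃ a : Fin n → M, typeOver (ElementaryEmbedding.refl L M) a ∈ U := by
  obtain ⟨p, hp⟩ := hne
  obtain ⟨_, ⟨ψ, rfl⟩, hpψ, hψU⟩ :=
    CompleteType.isTopologicalBasis_range_typesWith.exists_subset_of_mem_open hp hU
  -- A formula in a type is satisfiable in an elementary extension, hence in `M`.
  obtain ⟨K, v, rfl⟩ := Theory.exists_modelType_is_realized_in _ p
  have hv := Theory.CompleteType.mem_typeOf.1 hpψ
  let θ : L[[M]].Sentence :=
    Formula.iExs (Fin n) ((Formula.equivSentence.symm ψ).relabel (Sum.inr : _ → Empty ⊕ Fin n))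
  have hθM : θ ∈ L.elementaryDiagram M := by
    rw [elementaryDiagram, mem_completeTheory]
    by_contra hM
    have h1 : (K : Type _) ⊨ θ.not := (L.elementaryDiagram M).realize_sentence_of_mem
      (mem_completeTheory.2 ((Sentence.realize_not M).2 hM))
    refine (Sentence.realize_not K).1 h1 ?_
    rw [Sentence.Realize, Formula.realize_iExs]
    exact ⟨v, by rwa [Formula.realize_relabel, Sum.elim_comp_inr]⟩
  rw [elementaryDiagram, mem_completeTheory, Sentence.Realize, Formula.realize_iExs] at hθM
  obtain ⟨a, ha⟩ := hθM
  rw [Formula.realize_relabel, Sum.elim_comp_inr] at ha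
  have := model_elementaryDiagram (ElementaryEmbedding.refl L M)
  exact ⟨a, hψU (Theory.CompleteType.mem_typeOf.2 ha)⟩

/-- If `φ(x, y)` has NIP, then the family of the clopen sets `[φ(x, b)]` shatters no `k` types for
some `k`: shattered types could be replaced by types realized in `M`. -/
theorem exists_not_shattersPoints_clopen {T : L.Theory} [M ⊨ T] {φ : L.Formula (Fin n ⊕ Fin m)}
    (hφ : FormulaNIP.{u, v, w} T φ) :
    ∃ k, ¬ ShattersPoints (clopen φ : (Fin m → M) → Set (TypeSpace L M n)) k := by
  classical
  obtain ⟨k, hk⟩ := hφ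
  refine ⟨k, ?_⟩
  rintro ⟨p, b, hpb⟩
  have key : ∀ i, ∃ a : Fin n → M, ∀ S, φ.Realize (Sum.elim a (b S)) ↔ i ∈ S := by
    intro i
    obtain ⟨a, ha⟩ := exists_typeOver_mem
      (U := ⋂ S : Set (Fin k), if i ∈ S then clopen φ (b S) else (clopen φ (b S))ᶜ)
      (isOpen_iInter_of_finite fun S => by
        split_ifs
        · exact (isClopen_clopen φ _).2
        · exact (isClopen_clopen φ _).compl.2)
      ⟨p i, Set.mem_iInter.2 fun S => by
        have := hpb i S
        split_ifs with h
        · exact this.2 h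
        · exact fun h' => h (this.1 h')⟩
    refine ⟨a, fun S => ?_⟩
    have hS := Set.mem_iInter.1 ha S
    have h := typeOver_mem_clopen (ElementaryEmbedding.refl L M) a φ (b S)
    rw [show (ElementaryEmbedding.refl L M : M → M) ∘ b S = b S from rfl] at h
    rw [← h]
    split_ifs at hS with hi
    · exact iff_of_true hS hi
    · exact iff_of_false hS hi
  choose a ha using key
  -- A copy of `M` in the universe of the models which `FormulaNIP` speaks about.
  let N : Theory.ModelType.{u, v, max u v w} T :=
    Theory.ModelType.ulift.{u, v, w, max u v} (Theory.ModelType.of T M)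
  let e : M ≃[L] N := Equiv.ulift.{max u v, w}.symm.inducedStructureEquiv
  refine hk N ⟨fun i => e ∘ a i, fun S => e ∘ b S, fun i S => ?_⟩
  rw [← ha i S, ← Sum.comp_elim, StrongHomClass.realize_formula e]

end Types

/-! ### Definability of measures -/

section Separation

variable {L : FirstOrder.Language.{u, v}} {M : Type w} [L.Structure M] [Nonempty M] {n m : ℕ}

/-- The separation property for measures given on a set mapped to `S_n(M)`.  Up to a small error,
the measure of `[φ(x, b)]` depends only on which ones of finitely many types contain `φ(x, b)`, and
this is a definable property of `b`. -/
theorem exists_definable_separating {T : L.Theory} [M ⊨ T] {φ : L.Formula (Fin n ⊕ Fin m)}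
    (hφ : FormulaNIP.{u, v, w} T φ) (hdef : ∀ p : TypeSpace L M n, IsDefinableType p)
    {X : Type*} {C : Set (Set X)} {μ : Set X → ℝ} (hμ : IsFinAddProb C μ)
    {τ : X → TypeSpace L M n} (hτ : ∀ b, τ ⁻¹' clopen φ b ∈ C) {C₁ C₂ : Set ℝ}
    (hC₁ : C₁ ⊆ Set.Icc 0 1) (hC₁' : IsClosed C₁) (hC₂' : IsClosed C₂) (hd : Disjoint C₁ C₂) :
    ∃ D : Set (Fin m → M), (Set.univ : Set M).Definable L D ∧
      {b | μ (τ ⁻¹' clopen φ b) ∈ C₁} ⊆ D ∧ Disjoint D {b | μ (τ ⁻¹' clopen φ b) ∈ C₂} := by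
  classical
  obtain ⟨k, hk⟩ := exists_not_shattersPoints_clopen (M := M) hφ
  obtain ⟨δ, hδ, hdis⟩ := hd.exists_thickenings (isCompact_Icc.of_isClosed_subset hC₁' hC₁) hC₂'
  obtain ⟨N, p, hp⟩ := hμ.exists_points_abs_sub_lt (isClopen_clopen φ) hτ hk hδ
  let R : Set (Fin N) → Set (Fin m → M) := fun S => {b | ∀ i, p i ∈ clopen φ b ↔ i ∈ S}
  have hR : ∀ S, (Set.univ : Set M).Definable L (R S) := by
    intro S
    have : R S = ⋂ i, if i ∈ S then {b | p i ∈ clopen φ b} else {b | p i ∈ clopen φ b}ᶜ := by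
      ext b
      simp only [Set.mem_iInter]
      refine forall_congr' fun i => ?_
      split_ifs with h
      · exact iff_true_right h
      · exact iff_false_right h
    rw [this]
    refine Set.definable_iInter_of_finite fun i => ?_
    split_ifs
    · exact hdef (p i) m φ
    · exact (hdef (p i) m φ).compl
  let Q : Finset (Set (Fin N)) := {S | ∃ b ∈ R S, μ (τ ⁻¹' clopen φ b) ∈ C₁}
  refine ⟨⋃ S ∈ Q, R S, Set.definable_biUnion_finset hR Q, ?_, ?_⟩
  · intro b hb
    refine Set.mem_iUnion₂.2 ⟨{i | p i ∈ clopen φ b}, ?_, fun i => Iff.rfl⟩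
    exact Finset.mem_filter.2 ⟨Finset.mem_univ _, b, fun i => Iff.rfl, hb⟩
  · rw [Set.disjoint_left]
    intro b hb hb₂
    obtain ⟨S, hS, hbS⟩ := Set.mem_iUnion₂.1 hb
    obtain ⟨b', hb'S, hb'⟩ := (Finset.mem_filter.1 hS).2
    exact Set.disjoint_left.1 hdis (Metric.mem_thickening_iff.2
      ⟨_, hb', hp b b' fun i => (hbS i).trans (hb'S i).symm⟩)
      (Metric.self_subset_thickening hδ _ hb₂)

theorem isDefinableMeasure {T : L.Theory} [M ⊨ T] (hT : TheoryNIP.{u, v, w} T)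
    (hdef : ∀ p : TypeSpace L M n, IsDefinableType p) [MeasurableSpace (TypeSpace L M n)]
    [BorelSpace (TypeSpace L M n)] (μ : MeasureTheory.Measure (TypeSpace L M n))
    [MeasureTheory.IsProbabilityMeasure μ] : IsDefinableMeasure μ := by
  intro m φ C₁ C₂ h₁ _ h₁' h₂' hd
  have hμ : IsFinAddProb {A : Set (TypeSpace L M n) | MeasurableSet A} μ.real :=
    { isSetAlgebra := ⟨MeasurableSet.empty, fun _ h => h.compl, fun _ _ h h' => h.union h'⟩
      nonneg := fun _ _ => MeasureTheory.measureReal_nonneg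
      univ := MeasureTheory.probReal_univ
      union := fun _ _ _ hB h => MeasureTheory.measureReal_union h hB }
  exact exists_definable_separating (hT n m φ) hdef hμ (τ := id)
    (fun b => (isClopen_clopen φ b).2.measurableSet) h₁ h₁' h₂' hd

end Separation

/-! ### Definable sets and their parameters -/

section DefinableSets

variable {L : FirstOrder.Language.{u, v}} {N : Type w₁} [L.Structure N] {α : Type*}

theorem definable_setOf_realize {κ : Type*} {A : Set N} (φ : L.Formula (κ ⊕ α)) {t : κ → N}
    (ht : ∀ c, t c ∈ A) : A.Definable L {x | φ.Realize (Sum.elim t x)} := by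
  refine Set.definable_iff_exists_formula_sum.2
    ⟨φ.relabel (Sum.map (fun c => (⟨t c, ht c⟩ : A)) id), ?_⟩
  ext x
  simp only [Set.mem_ofPred_eq, Formula.realize_relabel, Sum.elim_comp_map]
  rfl

/-- Substituting the parameters `b` for `y` in `φ(x, y)` by renaming variables. -/
theorem realize_relabel_params {κ β : Type*} (φ : L.Formula (α ⊕ β)) (b : β → κ) (t : κ → N)
    (x : α → N) : (φ.relabel (Sum.elim Sum.inr (Sum.inl ∘ b))).Realize (Sum.elim t x) ↔
      φ.Realize (Sum.elim x (t ∘ b)) := by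
  rw [Formula.realize_relabel, Sum.comp_elim, Sum.elim_comp_inr, ← Function.comp_assoc,
    Sum.elim_comp_inl]

theorem definable_setOf_realize_left {β : Type*} (φ : L.Formula (α ⊕ β)) (b : β → N) :
    (Set.univ : Set N).Definable L {x | φ.Realize (Sum.elim x b)} := by
  have h := definable_setOf_realize (A := Set.univ)
    (φ.relabel (Sum.elim Sum.inr (Sum.inl ∘ b))) (t := id) fun _ => Set.mem_univ _
  simp only [realize_relabel_params] at h
  exact h

theorem exists_formula_of_definable {X : Set (α → N)} (hX : (Set.univ : Set N).Definable L X) :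
    ∃ φ : L.Formula (N ⊕ α), X = {x | φ.Realize (Sum.elim id x)} := by
  obtain ⟨φ, rfl⟩ := Set.definable_iff_exists_formula_sum.1 hX
  refine ⟨φ.relabel (Sum.map Subtype.val id), ?_⟩
  ext x
  simp only [Set.mem_ofPred_eq, Formula.realize_relabel, Sum.elim_comp_map]
  rfl

theorem isSetAlgebra_definable (A : Set N) :
    MeasureTheory.IsSetAlgebra {X : Set (α → N) | A.Definable L X} where
  empty_mem := Set.definable_empty
  compl_mem _ h := h.compl
  union_mem _ _ h h' := h.union h'

end DefinableSets

/-! ### Elementary extensions as limits of specializations -/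

section Specialization

variable {L : FirstOrder.Language.{u, v}} {M : Type w} [L.Structure M]
  {N' : Type w₂} [L.Structure N'] (f' : M ↪ₑ[L] N')

/-- A formula with parameters in `N'` which is true there becomes true in `M` after a suitable
replacement of the parameters which fixes those in `M`: the finitely many parameters outside `M` are
replaced by witnesses, in `M`, of an existential formula. -/
theorem exists_leftInverse_realize [Nonempty M] {θ : L.Formula N'} (hθ : θ.Realize id) :
    ∃ s : N' → M, s ∘ f' = id ∧ θ.Realize s := by
  classical
  let V := θ.freeVarFinset
  let ρ : N' → M ⊕ V := fun c =>
    if h : ∃ a, f' a = c then Sum.inl h.choose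
    else if hc : c ∈ V then Sum.inr ⟨c, hc⟩ else Sum.inl (Classical.arbitrary M)
  have hρ : ∀ a, ρ (f' a) = Sum.inl a := by
    intro a
    have h : ∃ a', f' a' = f' a := ⟨a, rfl⟩
    simp only [ρ, dif_pos h]
    exact congrArg _ (f'.injective h.choose_spec)
  have h1 : (Formula.iExs V (θ.relabel ρ)).Realize f' := by
    rw [Formula.realize_iExs]
    refine ⟨fun c => c, ?_⟩
    rw [Formula.realize_relabel]
    have h2 := BoundedFormula.realize_restrictFreeVar (φ := θ) (f := fun c => c.1)
      (v := Sum.elim f' (fun c : V => (c : N')) ∘ ρ) (xs := default)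
      (Sum.elim f' (fun c : V => (c : N')) ∘ ρ) (fun _ => rfl)
    have h3 := BoundedFormula.realize_restrictFreeVar (φ := θ) (f := fun c => c.1)
      (v := Sum.elim f' (fun c : V => (c : N')) ∘ ρ) (xs := default)
      id (fun c => by
        by_cases h : ∃ a, f' a = c
        · obtain ⟨a, ha⟩ := h
          simp [← ha, hρ]
        · simp [ρ, h, V])
    exact (h2.symm.trans h3).2 hθ
  have h2 : (Formula.iExs V (θ.relabel ρ)).Realize (id : M → M) :=
    (f'.map_formula _ id).1 h1
  rw [Formula.realize_iExs] at h2
  obtain ⟨y, hy⟩ := h2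
  rw [Formula.realize_relabel] at hy
  refine ⟨Sum.elim id y ∘ ρ, ?_, hy⟩
  ext a
  simp [hρ]

/-- An elementary extension `f' : M → N'` is a limit of left inverses of `f'`: along some
ultrafilter, they preserve and reflect the truth of formulas.  (So `N'` embeds into an ultrapower
of `M`.) -/
theorem exists_ultrafilter_leftInverse [Nonempty M] : ∃ 𝒰 : Ultrafilter (N' → M),
    (∀ᶠ s : N' → M in 𝒰, s ∘ f' = id) ∧
      ∀ θ : L.Formula N', θ.Realize id ↔ ∀ᶠ s : N' → M in 𝒰, θ.Realize s := by
  let Θ := {θ : L.Formula N' // θ.Realize id}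
  let F : Filter (N' → M) := ⨅ θ : Θ, 𝓟 {s | s ∘ f' = id ∧ θ.1.Realize s}
  have : Nonempty Θ := ⟨⟨⊤, by simp⟩⟩
  have hF : F.NeBot := by
    refine iInf_neBot_of_directed' ?_ fun θ => ?_
    · intro θ₁ θ₂
      refine ⟨⟨θ₁.1 ⊓ θ₂.1, Formula.realize_inf.2 ⟨θ₁.2, θ₂.2⟩⟩, ?_, ?_⟩
      · exact principal_mono.2 fun s hs => ⟨hs.1, (Formula.realize_inf.1 hs.2).1⟩
      · exact principal_mono.2 fun s hs => ⟨hs.1, (Formula.realize_inf.1 hs.2).2⟩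
    · exact principal_neBot_iff.2 (exists_leftInverse_realize f' θ.2)
  have hmem : ∀ θ : Θ, ∀ᶠ s in Ultrafilter.of F, s ∘ f' = id ∧ θ.1.Realize s := fun θ =>
    Ultrafilter.of_le F (mem_iInf_of_mem θ (mem_principal_self _))
  refine ⟨Ultrafilter.of F, (hmem (Classical.arbitrary Θ)).mono fun s hs => hs.1, fun θ =>
    ⟨fun h => (hmem ⟨θ, h⟩).mono fun s hs => hs.2, fun h => ?_⟩⟩
  by_contra hθ
  obtain ⟨s, hs, hs'⟩ := (h.and (hmem ⟨θ.not, Formula.realize_not.2 hθ⟩)).exists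
  exact Formula.realize_not.1 hs'.2 hs

variable {f'} {𝒰 : Ultrafilter (N' → M)}

/-- Universal truths of `N'` with parameters hold in `N` for almost all specializations `s : N' → M`
of the parameters, for every elementary extension `f : M → N`. -/
theorem eventually_forall_realize
    (h𝒰 : ∀ θ : L.Formula N', θ.Realize id ↔ ∀ᶠ s : N' → M in 𝒰, θ.Realize s)
    {N : Type w₁} [L.Structure N] (f : M ↪ₑ[L] N) {γ : Type*} [Finite γ] {χ : L.Formula (N' ⊕ γ)}
    (h : ∀ x : γ → N', χ.Realize (Sum.elim id x)) :
    ∀ᶠ s in 𝒰, ∀ x : γ → N, χ.Realize (Sum.elim (f ∘ s) x) := by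
  have h1 := (h𝒰 (χ.iAlls γ)).1 (Formula.realize_iAlls.2 h)
  refine h1.mono fun s hs => ?_
  rw [← f.map_formula] at hs
  exact Formula.realize_iAlls.1 hs

/-- A finitely additive measure on the definable sets of `N` has a limit along an ultrafilter
of specializations `s : N' → M`, which is a function of definable sets of `N'`. -/
theorem exists_limit_measure
    (h𝒰 : ∀ θ : L.Formula N', θ.Realize id ↔ ∀ᶠ s : N' → M in 𝒰, θ.Realize s)
    {N : Type w₁} [L.Structure N] (f : M ↪ₑ[L] N) {n : ℕ} {μ : Set (Fin n → N) → ℝ}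
    (hμ : IsFinAddProb {X | (Set.univ : Set N).Definable L X} μ) :
    ∃ ν : Set (Fin n → N') → ℝ, ∀ φ : L.Formula (N' ⊕ Fin n),
      Tendsto (fun s : N' → M => μ {x | φ.Realize (Sum.elim (f ∘ s) x)}) 𝒰
        (𝓝 (ν {x | φ.Realize (Sum.elim id x)})) := by
  classical
  have hlim : ∀ φ : L.Formula (N' ⊕ Fin n), ∃ r,
      Tendsto (fun s : N' → M => μ {x | φ.Realize (Sum.elim (f ∘ s) x)}) 𝒰 (𝓝 r) := by
    intro φ
    obtain ⟨r, -, hr⟩ := isCompact_Icc.ultrafilter_le_nhds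
      (𝒰.map fun s : N' → M => μ {x | φ.Realize (Sum.elim (f ∘ s) x)})
      (le_principal_iff.2 (mem_map.2 (univ_mem' fun s =>
        hμ.mem_Icc (definable_setOf_realize φ fun _ => Set.mem_univ _))))
    exact ⟨r, hr⟩
  choose r hr using hlim
  let ν : Set (Fin n → N') → ℝ := fun X =>
    if h : ∃ φ : L.Formula (N' ⊕ Fin n), X = {x | φ.Realize (Sum.elim id x)} then r h.choose else 0
  refine ⟨ν, fun φ => ?_⟩
  have h : ∃ ψ : L.Formula (N' ⊕ Fin n), {x : Fin n → N' | φ.Realize (Sum.elim id x)} =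
    {x | ψ.Realize (Sum.elim id x)} := ⟨φ, rfl⟩
  simp only [ν, dif_pos h]
  -- `φ` and the formula chosen for `ν` are equivalent in `N'`, so also in `N` for almost all `s`.
  have hev := eventually_forall_realize h𝒰 f (χ := φ.iff h.choose) fun x =>
    Formula.realize_iff.2 (Set.ext_iff.1 h.choose_spec x)
  refine (hr h.choose).congr' (hev.mono fun s hs => congrArg μ ?_)
  ext x
  exact (Formula.realize_iff.1 (hs x)).symm

end Specialization

/-! ### Definable groups -/

namespace DefinableGroup

variable {L : FirstOrder.Language.{u, v}} {M : Type w} [L.Structure M] {n : ℕ}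
  (G : DefinableGroup L M n) {N' : Type w₂} [L.Structure N'] (f' : M ↪ₑ[L] N')

/-- The formula defining `G`, with the parameters taken from `N'`. -/
def pointsFormula : L.Formula (N' ⊕ Fin n) :=
  G.dom.relabel (Sum.map f' id)

/-- The formula defining the left translate by `g` of the subset of `G` defined by `φ`. -/
noncomputable def translateFormula (g : Fin n → N') (φ : L.Formula (N' ⊕ Fin n)) :
    L.Formula (N' ⊕ Fin n) :=
  G.pointsFormula f' ⊓ Formula.iExs (Fin n)
    (φ.relabel (Sum.elim (Sum.inl ∘ Sum.inl) Sum.inr) ⊓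
      G.mul.relabel (Sum.elim (Sum.inl ∘ Sum.inl ∘ f')
        (Sum.elim (Sum.inl ∘ Sum.inl ∘ g) (Sum.elim Sum.inr (Sum.inl ∘ Sum.inr)))))

variable {f'} {N : Type w₁} [L.Structure N] {f : M ↪ₑ[L] N} {t : N' → N}

theorem realize_pointsFormula (ht : t ∘ f' = f) (x : Fin n → N) :
    (G.pointsFormula f').Realize (Sum.elim t x) ↔ x ∈ G.points f := by
  rw [pointsFormula, Formula.realize_relabel, Sum.elim_comp_map, ht]
  rfl

theorem realize_translateFormula (ht : t ∘ f' = f) (g : Fin n → N') (φ : L.Formula (N' ⊕ Fin n))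
    (z : Fin n → N) : (G.translateFormula f' g φ).Realize (Sum.elim t z) ↔
      z ∈ G.leftTranslate f (t ∘ g) {x | φ.Realize (Sum.elim t x)} := by
  rw [translateFormula, Formula.realize_inf, G.realize_pointsFormula ht, Formula.realize_iExs]
  refine and_congr_right fun _ => exists_congr fun x => ?_
  rw [Formula.realize_inf, Formula.realize_relabel, Formula.realize_relabel]
  have h1 : Sum.elim (Sum.elim t z) x ∘ Sum.elim (Sum.inl ∘ Sum.inl) Sum.inr = Sum.elim t x := by
    ext (i | i) <;> rfl
  have h2 : Sum.elim (Sum.elim t z) x ∘ Sum.elim (Sum.inl ∘ Sum.inl ∘ f')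
      (Sum.elim (Sum.inl ∘ Sum.inl ∘ g) (Sum.elim Sum.inr (Sum.inl ∘ Sum.inr)))
      = Sum.elim f (Sum.elim (t ∘ g) (Sum.elim x z)) := by
    rw [← ht]
    ext (i | i | i | i) <;> rfl
  rw [h1, h2]
  rfl

theorem definable_points (f : M ↪ₑ[L] N) : (Set.univ : Set N).Definable L (G.points f) :=
  definable_setOf_realize _ fun _ => Set.mem_univ _

variable {G} in
/-- An invariant measure on `G(N)`, seen as a measure on the definable subsets of `N ^ n`. -/
theorem IsInvariantMeasure.isFinAddProb {ν : Set (Fin n → N) → ℝ} (hν : G.IsInvariantMeasure f ν) :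
    IsFinAddProb {X | (Set.univ : Set N).Definable L X} fun X => ν (G.points f ∩ X) where
  isSetAlgebra := isSetAlgebra_definable _
  nonneg X hX := hν.nonneg _ Set.inter_subset_left ((G.definable_points f).inter hX)
  univ := by simpa using hν.total
  union X hX Y hY h := by
    rw [Set.inter_union_distrib_left]
    exact hν.additive _ Set.inter_subset_left _ Set.inter_subset_left
      ((G.definable_points f).inter hX) ((G.definable_points f).inter hY)
      (h.mono Set.inter_subset_right Set.inter_subset_right)

/-- If `G` is definably amenable in `N`, then in `N'` this is witnessed by an `M`-definable measure:
the limit of the given measure along specializations `N' → M`.  Invariance passes to the limit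
because a translate is given by a formula; definability is the separation property of the
restriction of the given measure to the sets defined over `M`. -/
theorem exists_invariant_definable_measure {T : L.Theory} [Nonempty M] [M ⊨ T]
    (hT : TheoryNIP.{u, v, w} T) (hdef : ∀ p : TypeSpace L M n, IsDefinableType p)
    (f : M ↪ₑ[L] N) (f' : M ↪ₑ[L] N') (hG : G.IsDefinablyAmenable f) :
    ∃ ν : Set (Fin n → N') → ℝ, G.IsInvariantMeasure f' ν ∧ G.IsDefinableOver f' ν := by
  obtain ⟨ν₀, hν₀⟩ := hG
  have hμ := hν₀.isFinAddProb
  obtain ⟨𝒰, hid, h𝒰⟩ := exists_ultrafilter_leftInverse f'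
  obtain ⟨ν, hν⟩ := exists_limit_measure h𝒰 f hμ
  have hid' : ∀ᶠ s : N' → M in 𝒰, (f ∘ s) ∘ f' = f := hid.mono fun s hs => by
    rw [Function.comp_assoc, hs, Function.comp_id]
  have hpts : G.points f' = {x | (G.pointsFormula f').Realize (Sum.elim id x)} := by
    ext x
    exact (G.realize_pointsFormula (f := f') (t := id) rfl x).symm
  refine ⟨ν, ⟨?_, ?_, ?_, ?_⟩, ?_⟩
  · intro X _ hX
    obtain ⟨φ, rfl⟩ := exists_formula_of_definable hX
    exact ge_of_tendsto' (hν φ) fun s =>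
      hμ.nonneg _ (definable_setOf_realize φ fun _ => Set.mem_univ _)
  · rw [hpts]
    refine tendsto_nhds_unique (hν _) (tendsto_const_nhds.congr' (hid'.mono fun s hs => ?_))
    have : {x | (G.pointsFormula f').Realize (Sum.elim (f ∘ s) x)} = G.points f := by
      ext x
      exact G.realize_pointsFormula hs x
    simp only [this, Set.inter_self, hν₀.total]
  · intro X _ Y _ hX hY hXY
    obtain ⟨φ, rfl⟩ := exists_formula_of_definable hX
    obtain ⟨ψ, rfl⟩ := exists_formula_of_definable hY
    have hunion : {x : Fin n → N' | φ.Realize (Sum.elim id x)} ∪ {x | ψ.Realize (Sum.elim id x)} =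
        {x | (φ ⊔ ψ).Realize (Sum.elim id x)} := by
      ext x
      exact Formula.realize_sup.symm
    have hdisj := eventually_forall_realize h𝒰 f (χ := (φ ⊓ ψ).not) fun x =>
      Formula.realize_not.2 fun h =>
        Set.disjoint_left.1 hXY (Formula.realize_inf.1 h).1 (Formula.realize_inf.1 h).2
    rw [hunion]
    refine tendsto_nhds_unique (hν _) (((hν φ).add (hν ψ)).congr' (hdisj.mono fun s hs => ?_))
    rw [← hμ.union _ (definable_setOf_realize φ fun _ => Set.mem_univ _) _
      (definable_setOf_realize ψ fun _ => Set.mem_univ _)]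
    · congr 2
      ext x
      exact Formula.realize_sup.symm
    · exact Set.disjoint_left.2 fun x h h' =>
        Formula.realize_not.1 (hs x) (Formula.realize_inf.2 ⟨h, h'⟩)
  · intro g hg X hXG hX
    obtain ⟨φ, rfl⟩ := exists_formula_of_definable hX
    have htr : G.leftTranslate f' g {x | φ.Realize (Sum.elim id x)} =
        {z | (G.translateFormula f' g φ).Realize (Sum.elim id z)} := by
      ext z
      exact (G.realize_translateFormula (f := f') (t := id) rfl g φ z).symm
    -- For almost all `s`, the specializations of `X` and `g` are a subset and an element of `G(N)`.
    have hsub := eventually_forall_realize h𝒰 f (χ := φ.imp (G.pointsFormula f')) fun x =>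
      Formula.realize_imp.2 fun hx => (Set.ext_iff.1 hpts x).1 (hXG hx)
    have hgs : ∀ᶠ s : N' → M in 𝒰,
        (G.pointsFormula f').Realize (Sum.elim (f ∘ s) ((f ∘ s) ∘ g)) := by
      have := (h𝒰 ((G.pointsFormula f').relabel (Sum.elim id g))).1 (by
        rw [Formula.realize_relabel]
        have := (Set.ext_iff.1 hpts g).1 hg
        rwa [Function.id_comp])
      refine this.mono fun s hs => ?_
      rw [← f.map_formula, Formula.realize_relabel] at hs
      rwa [Sum.comp_elim, Function.comp_id] at hs
    rw [htr]
    refine tendsto_nhds_unique (hν _) ((hν φ).congr' ?_)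
    filter_upwards [hid', hsub, hgs] with s hs₁ hs₂ hs₃
    have hφG : {x | φ.Realize (Sum.elim (f ∘ s) x)} ⊆ G.points f := fun x hx =>
      (G.realize_pointsFormula hs₁ x).1 (Formula.realize_imp.1 (hs₂ x) hx)
    have htr' : {z | (G.translateFormula f' g φ).Realize (Sum.elim (f ∘ s) z)} =
        G.leftTranslate f ((f ∘ s) ∘ g) {x | φ.Realize (Sum.elim (f ∘ s) x)} := by
      ext z
      exact G.realize_translateFormula hs₁ g φ z
    rw [htr', Set.inter_eq_self_of_subset_right hφG,
      Set.inter_eq_self_of_subset_right fun z hz => hz.1]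
    exact (hν₀.left_invariant _ ((G.realize_pointsFormula hs₁ _).1 hs₃) _ hφG
      (definable_setOf_realize φ fun _ => Set.mem_univ _)).symm
  · intro m φ C₁ C₂ h₁ _ h₁' h₂' hd
    obtain ⟨δ, hδ, hdis⟩ :=
      hd.exists_cthickenings (isCompact_Icc.of_isClosed_subset h₁' h₁) h₂'
    have hτ : ∀ b : Fin m → M, typeOver f ⁻¹' clopen φ b =
        {x | φ.Realize (Sum.elim x (f ∘ b))} := fun b => by
      ext x
      exact typeOver_mem_clopen f x φ b
    obtain ⟨D, hD, hD₁, hD₂⟩ := exists_definable_separating (hT n m φ) hdef hμ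
      (fun b => by
        rw [hτ]
        exact definable_setOf_realize_left φ _)
      (C₁ := Metric.cthickening δ C₁ ∩ Set.Icc 0 1) (C₂ := Metric.cthickening δ C₂)
      Set.inter_subset_right (Metric.isClosed_cthickening.inter isClosed_Icc)
      Metric.isClosed_cthickening (hdis.mono_left Set.inter_subset_left)
    obtain ⟨ψ, rfl⟩ := exists_formula_of_definable hD
    -- The measure of `φ(x, b)` is the limit of the measures of `φ(x, s b)`, where `s b` is in `M`.
    have hlim : ∀ b : Fin m → N', Tendsto
        (fun s : N' → M => ν₀ (G.points f ∩ typeOver f ⁻¹' clopen φ (s ∘ b))) 𝒰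
        (𝓝 (ν (G.points f' ∩ {x | φ.Realize (Sum.elim x b)}))) := by
      intro b
      let θ := G.pointsFormula f' ⊓ φ.relabel (Sum.elim Sum.inr (Sum.inl ∘ b))
      have hθ : G.points f' ∩ {x | φ.Realize (Sum.elim x b)} =
          {x | θ.Realize (Sum.elim id x)} := by
        ext x
        refine Iff.trans (and_congr (Set.ext_iff.1 hpts x) ?_) Formula.realize_inf.symm
        exact (realize_relabel_params φ b id x).symm
      rw [hθ]
      refine (hν θ).congr' (hid'.mono fun s hs => congrArg ν₀ ?_)
      rw [hτ]
      ext x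
      refine and_congr_right fun hx => ?_
      refine Formula.realize_inf.trans
        ((and_iff_right ((G.realize_pointsFormula hs x).2 hx)).trans ?_)
      exact realize_relabel_params φ b (f ∘ s) x
    -- A tuple `b` of `N'` satisfies the separating formula if and only if almost all `s b` do.
    have hmem : ∀ b : Fin m → N', ψ.Realize (Sum.elim f' b) ↔
        ∀ᶠ s : N' → M in 𝒰, ψ.Realize (Sum.elim id (s ∘ b)) := by
      intro b
      have h := h𝒰 (ψ.relabel (Sum.elim f' b))
      rw [Formula.realize_relabel, Function.id_comp] at h
      rw [h]
      refine eventually_congr (hid.mono fun s hs => ?_)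
      rw [Formula.realize_relabel, Sum.comp_elim, hs]
    have hthick : ∀ (C : Set ℝ) (b : Fin m → N'),
        ν (G.points f' ∩ {x | φ.Realize (Sum.elim x b)}) ∈ C →
        ∀ᶠ s : N' → M in 𝒰,
          ν₀ (G.points f ∩ typeOver f ⁻¹' clopen φ (s ∘ b)) ∈ Metric.cthickening δ C :=
      fun C b hb => (hlim b).eventually_mem (mem_of_superset
        (Metric.isOpen_thickening.mem_nhds (Metric.self_subset_thickening hδ C hb))
        (Metric.thickening_subset_cthickening δ C))
    refine ⟨{b | ψ.Realize (Sum.elim f' b)}, definable_setOf_realize ψ Set.mem_range_self, ?_, ?_⟩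
    · intro b hb
      refine (hmem b).2 ((hthick C₁ b hb).mono fun s hs => hD₁ ⟨hs, hμ.mem_Icc ?_⟩)
      rw [hτ]
      exact definable_setOf_realize_left φ _
    · rw [Set.disjoint_left]
      intro b hb hb₂
      obtain ⟨s, hs, hs₂⟩ := (((hmem b).1 hb).and (hthick C₂ b hb₂)).exists
      exact Set.disjoint_left.1 hD₂ hs hs₂

end DefinableGroup

end NIPMeasure

theorem mainTheorem7 {L : FirstOrder.Language.{u, v}} (T : L.Theory) (hT : T.IsComplete)
    (hNIP : NIPMeasure.TheoryNIP.{u, v, w} T)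
    (M : Type w) [L.Structure M] [Nonempty M] [M ⊨ T] (n : ℕ)
    (hdef : ∀ p : NIPMeasure.TypeSpace L M n, NIPMeasure.IsDefinableType p) :
    (∀ [MeasurableSpace (NIPMeasure.TypeSpace L M n)] [BorelSpace (NIPMeasure.TypeSpace L M n)]
        (μ : MeasureTheory.Measure (NIPMeasure.TypeSpace L M n))
        [MeasureTheory.IsProbabilityMeasure μ],
        NIPMeasure.IsDefinableMeasure μ) ∧
    (∀ (G : NIPMeasure.DefinableGroup L M n)
        (N : Type w₁) [L.Structure N] (f : M ↪ₑ[L] N)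
        (N' : Type w₂) [L.Structure N'] (f' : M ↪ₑ[L] N'),
        G.IsDefinablyAmenable f →
        ∃ ν : Set (Fin n → N') → ℝ, G.IsInvariantMeasure f' ν ∧ G.IsDefinableOver f' ν) := by
  exact ⟨fun μ _ => NIPMeasure.isDefinableMeasure hNIP hdef μ, fun G _ _ f _ _ f' hG =>
    G.exists_invariant_definable_measure hNIP hdef f f' hG⟩
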